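/- Let $G=\mathrm{Isom}(\mathbb R^1_1)$ denote the simply connected three-dimensional Lie group of orientation- and time-orientation-preserving isometries of the Minkowski plane $\mathbb R^1_1$ (the identity component of its isometry group): in the global coordinates $(x,y,\theta)\in\mathbb R^3$ the element $(x,y,\theta)$ is the boost of rapidity $\theta$ followed by the translation by $(x,y)$. For a Riemannian metric $g$ on $G$ with Ricci tensor $R_{ij}$, scalar curvature $R$ and Levi-Civita connection $\nabla$, let $$C_{ij}=g_{ik}\,\varepsilon^{klm}\Bigl(\nabla_lR_{mj}-\tfrac14\nabla_lR\,g_{mj}\Bigr),\qquad \varepsilon^{klm}=\frac{\eta^{klm}}{\sqrt{\det g}},$$ be its Cotton–York tensor, where $\eta^{klm}$ is completely antisymmetric with $\eta^{123}=1$. For compact $K\subset G$ put $$C_K(g)=\int_K |C_2|_g\,d\mu_g,\qquad |C_2|_g^2=g^{ip}g^{jq}C_{ij}C_{pq}.$$ Let $g_0$ be any left-invariant Riemannian metric on $G$. Then there is a Ricci flow $\partial_t g=-2\,\mathrm{Ric}_{g}$, $t\in[0,\infty)$, of left-invariant metrics on $G$ with $g(0)=g_0$, and any Ricci flow of left-invariant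 metrics on an interval $[0,T)$ starting at $g_0$ coincides with it on $[0,T)$. For every compact set $K\subset G$, $$\lim_{t\to\infty}C_K(g(t))=0,$$ and if $K$ has positive measure, then $t\mapsto C_K(g(t))$ is strictly decreasing on $[0,\infty)$. -/

import Mathlib

open Set Filter Topology MeasureTheory
open scoped ContDiff

/-! ## The group `Isom(ℝ¹₁)` in global coordinates

`Isom(ℝ¹₁)` denotes the identity component (the simply connected three-dimensional group of proper
orthochronous isometries) of the isometry group of the Minkowski plane.  It is parametrised by
`(x, y, θ) ∈ ℝ³`: the boost of rapidity `θ` followed by the translation by `(x, y)`. -/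

namespace IsomMinkowski

/-- The Minkowski quadratic form on the plane. -/
def minkowskiForm (z : Fin 2 → ℝ) : ℝ := z 0 ^ 2 - z 1 ^ 2

/-- The isometry of the Minkowski plane with coordinates `p = (x, y, θ)`. -/
noncomputable def toIsom (p : Fin 3 → ℝ) (z : Fin 2 → ℝ) : Fin 2 → ℝ :=
  ![Real.cosh (p 2) * z 0 + Real.sinh (p 2) * z 1 + p 0,
    Real.sinh (p 2) * z 0 + Real.cosh (p 2) * z 1 + p 1]

/-- The group law of `Isom(ℝ¹₁)` in the coordinates `(x, y, θ)`; as a function of `q` it is the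
left translation by `p`. -/
noncomputable def mul (p q : Fin 3 → ℝ) : Fin 3 → ℝ :=
  ![Real.cosh (p 2) * q 0 + Real.sinh (p 2) * q 1 + p 0,
    Real.sinh (p 2) * q 0 + Real.cosh (p 2) * q 1 + p 1,
    p 2 + q 2]

/-- The group law is composition of isometries. -/
theorem toIsom_mul (p q : Fin 3 → ℝ) : toIsom (mul p q) = toIsom p ∘ toIsom q := by
  funext z
  ext i
  fin_cases i <;>
    simp [toIsom, mul, Real.cosh_add, Real.sinh_add] <;> ring

/-- The coordinates are faithful. -/
theorem toIsom_injective : Function.Injective toIsom := by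
  intro p q h
  have h0 := congrFun h 0
  have h1 := congrFun h ![1, 0]
  have e0 : p 0 = q 0 := by simpa [toIsom] using congrFun h0 0
  have e1 : p 1 = q 1 := by simpa [toIsom] using congrFun h0 1
  have e2 : p 2 = q 2 := by
    have := congrFun h1 1
    simpa [toIsom, e1] using this
  ext i
  fin_cases i <;> simp [e0, e1, e2]

/-- The coordinates describe exactly the maps of the Minkowski plane that preserve the Minkowski
form of differences, the orientation and the time orientation. -/
theorem range_toIsom :
    range toIsom = {f : (Fin 2 → ℝ) → (Fin 2 → ℝ) |
      (∀ z w, minkowskiForm (f z - f w) = minkowskiForm (z - w)) ∧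
      0 < (f ![1, 0] - f 0) 0 * (f ![0, 1] - f 0) 1 - (f ![0, 1] - f 0) 0 * (f ![1, 0] - f 0) 1 ∧
      0 < (f ![1, 0] - f 0) 0} := by
  ext f
  constructor
  · rintro ⟨p, rfl⟩
    have hcs := Real.cosh_sq (p 2)
    refine ⟨fun z w => ?_, ?_, ?_⟩
    · simp only [minkowskiForm, toIsom, Pi.sub_apply, Matrix.cons_val_zero, Matrix.cons_val_one]
      linear_combination ((z 0 - w 0) ^ 2 - (z 1 - w 1) ^ 2) * hcs
    · simp [toIsom]
      nlinarith [hcs]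
    · simpa [toIsom] using Real.cosh_pos (p 2)
  · rintro ⟨hQ, hdet, htime⟩
    set a := (f ![1, 0] - f 0) 0 with ha
    set c := (f ![1, 0] - f 0) 1 with hc
    set b := (f ![0, 1] - f 0) 0 with hb
    set d := (f ![0, 1] - f 0) 1 with hd
    have h1 : a ^ 2 - c ^ 2 = 1 := by
      have := hQ ![1, 0] 0
      simpa [minkowskiForm, ha, hc] using this
    have h2 : b ^ 2 - d ^ 2 = -1 := by
      have := hQ ![0, 1] 0
      simpa [minkowskiForm, hb, hd] using this
    have h3 : a * b = c * d := by
      have := hQ ![1, 0] ![0, 1]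
      simp only [minkowskiForm, Pi.sub_apply, Matrix.cons_val_zero, Matrix.cons_val_one] at this
      simp only [Pi.sub_apply] at ha hb hc hd
      have e1 : f ![1, 0] 0 - f ![0, 1] 0 = a - b := by rw [ha, hb]; ring
      have e2 : f ![1, 0] 1 - f ![0, 1] 1 = c - d := by rw [hc, hd]; ring
      rw [e1, e2] at this
      linear_combination (h1 + h2 - this) / 2
    have hD : a * d - b * c = 1 := by
      have : (a * d - b * c) ^ 2 = 1 := by
        linear_combination (-(b ^ 2 - d ^ 2)) * h1 - h2 + (a * b - c * d) * h3
      nlinarith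
    have hda : d = a := by linear_combination (-d) * h1 + a * hD + c * h3
    have hbc : b = c := by linear_combination (-b) * h1 + a * h3 + c * hD
    have hsinh : Real.sinh (Real.arsinh c) = c := Real.sinh_arsinh c
    have hcosh : Real.cosh (Real.arsinh c) = a := by
      rw [Real.cosh_arsinh, show 1 + c ^ 2 = a ^ 2 by linarith, Real.sqrt_sq htime.le]
    refine ⟨![f 0 0, f 0 1, Real.arsinh c], ?_⟩
    funext z
    have q0 := hQ z 0
    have q1 := hQ z ![1, 0]
    have q2 := hQ z ![0, 1]
    simp only [minkowskiForm, Pi.sub_apply, Matrix.cons_val_zero, Matrix.cons_val_one,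
      Pi.zero_apply, sub_zero] at q0 q1 q2
    simp only [Pi.sub_apply] at ha hb hc hd
    have r1 : a * (f z 0 - f 0 0) - c * (f z 1 - f 0 1) = z 0 := by
      rw [show f z 0 - f ![1, 0] 0 = (f z 0 - f 0 0) - a by rw [ha]; ring,
        show f z 1 - f ![1, 0] 1 = (f z 1 - f 0 1) - c by rw [hc]; ring] at q1
      linear_combination (q0 - q1 + h1) / 2
    have r2 : c * (f z 0 - f 0 0) - a * (f z 1 - f 0 1) = -z 1 := by
      rw [show f z 0 - f ![0, 1] 0 = (f z 0 - f 0 0) - b by rw [hb]; ring,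
        show f z 1 - f ![0, 1] 1 = (f z 1 - f 0 1) - d by rw [hd]; ring] at q2
      rw [hda, hbc] at q2
      linear_combination (q0 - q2 - h1) / 2
    ext i
    fin_cases i
    · simp [toIsom, hsinh, hcosh]
      linear_combination (f z 0 - f 0 0) * h1 - a * r1 + c * r2
    · simp [toIsom, hsinh, hcosh]
      linear_combination (f z 1 - f 0 1) * h1 - c * r1 + a * r2

end IsomMinkowski

/-! ## Riemannian geometry of `ℝ³` in global coordinates

A metric is given by its matrix of components `g x i j = g_{ij}(x)`. -/

namespace Riem3

/-- A smooth Riemannian metric on `ℝ³`. -/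
def IsMetric (g : (Fin 3 → ℝ) → Matrix (Fin 3) (Fin 3) ℝ) : Prop :=
  (∀ i j, ContDiff ℝ ∞ fun x => g x i j) ∧ ∀ x, (g x).PosDef

/-- The partial derivative `∂_i f`. -/
noncomputable def pd (i : Fin 3) (f : (Fin 3 → ℝ) → ℝ) (x : Fin 3 → ℝ) : ℝ :=
  fderiv ℝ f x (Pi.single i 1)

/-- The Christoffel symbol `Γ^k_{ij}` of the Levi-Civita connection. -/
noncomputable def christoffel (g : (Fin 3 → ℝ) → Matrix (Fin 3) (Fin 3) ℝ) (k i j : Fin 3)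
    (x : Fin 3 → ℝ) : ℝ :=
  (1 / 2) * ∑ l, (g x)⁻¹ k l *
    (pd i (fun y => g y j l) x + pd j (fun y => g y i l) x - pd l (fun y => g y i j) x)

/-- The component `R_{ijk}^l` of the curvature tensor, `R(∂_i, ∂_j) ∂_k = R_{ijk}^l ∂_l` with
`R(X, Y) = ∇_X ∇_Y - ∇_Y ∇_X - ∇_{[X, Y]}`. -/
noncomputable def curvature (g : (Fin 3 → ℝ) → Matrix (Fin 3) (Fin 3) ℝ) (i j k l : Fin 3)
    (x : Fin 3 → ℝ) : ℝ :=
  pd i (christoffel g l j k) x - pd j (christoffel g l i k) x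
    + ∑ m, (christoffel g l i m x * christoffel g m j k x
      - christoffel g l j m x * christoffel g m i k x)

/-- The Ricci tensor `R_{jk} = R_{ijk}^i`. -/
noncomputable def ricci (g : (Fin 3 → ℝ) → Matrix (Fin 3) (Fin 3) ℝ) (j k : Fin 3)
    (x : Fin 3 → ℝ) : ℝ :=
  ∑ i, curvature g i j k i x

/-- The scalar curvature. -/
noncomputable def scalar (g : (Fin 3 → ℝ) → Matrix (Fin 3) (Fin 3) ℝ) (x : Fin 3 → ℝ) : ℝ :=
  ∑ i, ∑ j, (g x)⁻¹ i j * ricci g i j x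

/-- The covariant derivative `∇_i R_{jk}` of the Ricci tensor. -/
noncomputable def covRicci (g : (Fin 3 → ℝ) → Matrix (Fin 3) (Fin 3) ℝ) (i j k : Fin 3)
    (x : Fin 3 → ℝ) : ℝ :=
  pd i (ricci g j k) x
    - ∑ m, (christoffel g m i j x * ricci g m k x + christoffel g m i k x * ricci g j m x)

/-- The completely antisymmetric symbol `η^{klm}` with `η^{012} = 1`. -/
noncomputable def eta (k l m : Fin 3) : ℝ :=
  (((l : ℕ) : ℝ) - ((k : ℕ) : ℝ)) * (((m : ℕ) : ℝ) - ((k : ℕ) : ℝ)) *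
    (((m : ℕ) : ℝ) - ((l : ℕ) : ℝ)) / 2

/-- The Cotton-York tensor
`C_{ij} = g_{ik} ε^{klm} (∇_l R_{mj} - (1/4) (∇_l R) g_{mj})`, `ε^{klm} = η^{klm} / √(det g)`. -/
noncomputable def cottonYork (g : (Fin 3 → ℝ) → Matrix (Fin 3) (Fin 3) ℝ) (i j : Fin 3)
    (x : Fin 3 → ℝ) : ℝ :=
  ∑ k, ∑ l, ∑ m, g x i k * (eta k l m / Real.sqrt (g x).det) *
    (covRicci g l m j x - (1 / 4) * pd l (scalar g) x * g x m j)

/-- The pointwise norm `|C₂|_g = (g^{ip} g^{jq} C_{ij} C_{pq})^{1/2}`. -/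
noncomputable def cottonYorkNorm (g : (Fin 3 → ℝ) → Matrix (Fin 3) (Fin 3) ℝ)
    (x : Fin 3 → ℝ) : ℝ :=
  Real.sqrt (∑ i, ∑ j, ∑ p, ∑ q,
    (g x)⁻¹ i p * (g x)⁻¹ j q * cottonYork g i j x * cottonYork g p q x)

/-- The `L¹`-norm `∫_K |C₂|_g dμ_g` with the Riemannian volume element `√(det g) dx`. -/
noncomputable def cottonYorkL1 (g : (Fin 3 → ℝ) → Matrix (Fin 3) (Fin 3) ℝ)
    (K : Set (Fin 3 → ℝ)) : ℝ :=
  ∫ x in K, cottonYorkNorm g x * Real.sqrt (g x).det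

/-- `g t`, `t ∈ I`, is a solution of the Ricci flow `∂g/∂t = -2 Ric_g`
(with the one-sided derivative at an end point of `I` that belongs to `I`). -/
def IsRicciFlowOn (I : Set ℝ) (g : ℝ → (Fin 3 → ℝ) → Matrix (Fin 3) (Fin 3) ℝ) : Prop :=
  (∀ t ∈ I, IsMetric (g t)) ∧
    ∀ t ∈ I, ∀ x i j, HasDerivWithinAt (fun s => g s x i j) (-2 * ricci (g t) i j x) I t

end Riem3

namespace IsomMinkowski

/-- The metric `g` on `Isom(ℝ¹₁)` is left-invariant: every left translation `L_p` is an isometry,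
`g_{L_p q}(dL_p v, dL_p w) = g_q(v, w)`. -/
def IsLeftInvariant (g : (Fin 3 → ℝ) → Matrix (Fin 3) (Fin 3) ℝ) : Prop :=
  ∀ p q v w : Fin 3 → ℝ,
    fderiv ℝ (mul p) q v ⬝ᵥ (g (mul p q)).mulVec (fderiv ℝ (mul p) q w) = v ⬝ᵥ (g q).mulVec w

/-- `g t`, `t ∈ I`, is a Ricci flow of left-invariant metrics on `Isom(ℝ¹₁)` starting at `g₀`. -/
def IsInvariantRicciFlow (I : Set ℝ) (g₀ : (Fin 3 → ℝ) → Matrix (Fin 3) (Fin 3) ℝ)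
    (g : ℝ → (Fin 3 → ℝ) → Matrix (Fin 3) (Fin 3) ℝ) : Prop :=
  Riem3.IsRicciFlowOn I g ∧ (∀ t ∈ I, IsLeftInvariant (g t)) ∧ g 0 = g₀

end IsomMinkowski

/-! A left-invariant metric is determined by its matrix at the identity. Split that matrix into a
planar block `!![m + n, b; b, m - n]` of determinant `D`, a shear `(p, q)`, and the squared length
`s` of the boost direction made orthogonal to the plane. Boosts fix `n`, `D`, `s` and act on `(m,
b)` by hyperbolic rotation, so every curvature quantity is a rational expression in these
parameters.

The Ricci flow keeps `p`, `q` fixed and becomes `m' = -4n²m/(sD)`, `b' = -4n²b/(sD)`, `n' = -4n(D +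
n²)/(sD)`, `s' = 4(D + n²)/D`. Hence `D`, `c = n s` and `b / m` are conserved, and only `s' = 4 +
4c²/(D s²)` remains. It is solved by inverting an integral, and `s` increases to infinity because
`s' ≥ 4`. See `hasDerivAt_flowMetric` for existence and `eq_flowMetric` for uniqueness.

By `cottonYorkNorm_invMetric` the Cotton–York density depends only on `n`, `D`, `s`. With `u = 1 /
s` and `n = c u` it is the square root of a polynomial in `u` that vanishes at `0` and strictly
increases for `u > 0`. As `t` grows, `u` decreases strictly to `0`, which gives both claims. -/

namespace IsomMinkowski

open Riem3

/-! ### Left-invariant metrics in parameters adapted to the boosts -/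

/-- The metric matrix `Sᵀ diag(P, s) S` with `P = !![m + n, b; b, m - n]` and `S` the shear by
`(p, q)`. -/
def frameMetric (m b n p q s : ℝ) : Matrix (Fin 3) (Fin 3) ℝ :=
  !![m + n, b, (m + n) * p + b * q;
    b, m - n, b * p + (m - n) * q;
    (m + n) * p + b * q, b * p + (m - n) * q,
      s + (m + n) * p ^ 2 + 2 * b * p * q + (m - n) * q ^ 2]

/-- The inverse of `frameMetric`, where `D = m ^ 2 - b ^ 2 - n ^ 2`. -/
noncomputable def frameMetricInv (m b n p q s D : ℝ) : Matrix (Fin 3) (Fin 3) ℝ :=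
  !![(m - n) / D + p ^ 2 / s, -b / D + p * q / s, -p / s;
    -b / D + p * q / s, (m + n) / D + q ^ 2 / s, -q / s;
    -p / s, -q / s, 1 / s]

theorem frameMetric_det (m b n p q s : ℝ) :
    (frameMetric m b n p q s).det = (m ^ 2 - b ^ 2 - n ^ 2) * s := by
  simp [frameMetric, Matrix.det_fin_three]
  ring

theorem frameMetric_inv {m b n p q s D : ℝ} (hs : s ≠ 0) (hD : D ≠ 0)
    (h : m ^ 2 - b ^ 2 - n ^ 2 = D) :
    (frameMetric m b n p q s)⁻¹ = frameMetricInv m b n p q s D := by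
  apply Matrix.inv_eq_right_inv
  subst h
  ext i j
  fin_cases i <;> fin_cases j <;>
    simp [frameMetric, frameMetricInv, Matrix.mul_apply, Fin.sum_univ_three] <;>
    field_simp <;> ring

/-- Hyperbolic rotation of `(m, b)`. -/
noncomputable def rotM (m b θ : ℝ) : ℝ := m * Real.cosh (2 * θ) - b * Real.sinh (2 * θ)

/-- Hyperbolic rotation of `(m, b)`, second component. -/
noncomputable def rotB (m b θ : ℝ) : ℝ := b * Real.cosh (2 * θ) - m * Real.sinh (2 * θ)

/-- Hyperbolic rotation of `(p, q)`. -/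
noncomputable def rotP (p q θ : ℝ) : ℝ := p * Real.cosh θ + q * Real.sinh θ

theorem hasDerivAt_rotM (m b θ : ℝ) : HasDerivAt (rotM m b) (-2 * rotB m b θ) θ := by
  have h : HasDerivAt (fun x : ℝ => 2 * x) 2 θ := by simpa using (hasDerivAt_id θ).const_mul 2
  refine ((h.cosh.const_mul m).sub (h.sinh.const_mul b)).congr_deriv ?_
  simp only [rotB]; ring

theorem hasDerivAt_rotB (m b θ : ℝ) : HasDerivAt (rotB m b) (-2 * rotM m b θ) θ := by
  have h : HasDerivAt (fun x : ℝ => 2 * x) 2 θ := by simpa using (hasDerivAt_id θ).const_mul 2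
  refine ((h.cosh.const_mul b).sub (h.sinh.const_mul m)).congr_deriv ?_
  simp only [rotM]; ring

theorem hasDerivAt_rotP (p q θ : ℝ) : HasDerivAt (rotP p q) (rotP q p θ) θ := by
  refine (((Real.hasDerivAt_cosh θ).const_mul p).add
    ((Real.hasDerivAt_sinh θ).const_mul q)).congr_deriv ?_
  simp only [rotP]; ring

theorem rot_sq_sub_sq (m b θ : ℝ) : rotM m b θ ^ 2 - rotB m b θ ^ 2 = m ^ 2 - b ^ 2 := by
  have := Real.cosh_sq (2 * θ)
  simp only [rotM, rotB]
  linear_combination (m ^ 2 - b ^ 2) * this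

/-- The left-invariant metric with value `frameMetric m b n p q s` at the identity. -/
noncomputable def invMetric (m b n p q s : ℝ) (x : Fin 3 → ℝ) : Matrix (Fin 3) (Fin 3) ℝ :=
  frameMetric (rotM m b (x 2)) (rotB m b (x 2)) n (rotP p q (x 2)) (rotP q p (x 2)) s

/-- Left translations by `(x, y, 0)` are ordinary translations, so left-invariant coefficients
depend on the rapidity alone and only the last partial derivative survives. -/
theorem pd_comp_apply_two {F : ℝ → ℝ} {x : Fin 3 → ℝ} {F' : ℝ} (h : HasDerivAt F F' (x 2))
    (i : Fin 3) : pd i (fun y => F (y 2)) x = if i = 2 then F' else 0 := by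
  have h2 : HasFDerivAt (fun y : Fin 3 → ℝ => y 2)
      (ContinuousLinearMap.proj (R := ℝ) (φ := fun _ : Fin 3 => ℝ) 2) x :=
    (ContinuousLinearMap.proj (R := ℝ) (φ := fun _ : Fin 3 => ℝ) 2).hasFDerivAt
  have := h.comp_hasFDerivAt x h2
  have e : fderiv ℝ (fun y : Fin 3 → ℝ => F (y 2)) x = _ := this.fderiv
  rw [pd, e]
  fin_cases i <;> simp

/-- Separates differentiability, left to `fun_prop`, from the value of the derivative, left to
`simp`. -/
theorem hasDerivAt_of_deriv_eq {F : ℝ → ℝ} {θ F' : ℝ} (h : DifferentiableAt ℝ F θ)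
    (e : deriv F θ = F') : HasDerivAt F F' θ := e ▸ h.hasDerivAt

/-! ### Levi-Civita connection -/

/-- Derivative of the metric coefficients along the boosts. -/
def frameMetricDeriv (m b n p q : ℝ) : Matrix (Fin 3) (Fin 3) ℝ :=
  !![-2 * b, -2 * m, -(b * p + (m - n) * q);
    -2 * m, -2 * b, -((m + n) * p + b * q);
    -(b * p + (m - n) * q), -((m + n) * p + b * q), 0]

@[fun_prop] theorem differentiable_rotM (m b : ℝ) : Differentiable ℝ (rotM m b) :=
  fun θ => (hasDerivAt_rotM m b θ).differentiableAt
@[fun_prop] theorem differentiable_rotB (m b : ℝ) : Differentiable ℝ (rotB m b) :=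
  fun θ => (hasDerivAt_rotB m b θ).differentiableAt
@[fun_prop] theorem differentiable_rotP (p q : ℝ) : Differentiable ℝ (rotP p q) :=
  fun θ => (hasDerivAt_rotP p q θ).differentiableAt
@[simp] theorem deriv_rotM (m b θ : ℝ) : deriv (rotM m b) θ = -2 * rotB m b θ :=
  (hasDerivAt_rotM m b θ).deriv
@[simp] theorem deriv_rotB (m b θ : ℝ) : deriv (rotB m b) θ = -2 * rotM m b θ :=
  (hasDerivAt_rotB m b θ).deriv
@[simp] theorem deriv_rotP (p q θ : ℝ) : deriv (rotP p q) θ = rotP q p θ :=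
  (hasDerivAt_rotP p q θ).deriv

theorem hasDerivAt_frameMetric (m b n p q s θ : ℝ) (i j : Fin 3) :
    HasDerivAt (fun θ => frameMetric (rotM m b θ) (rotB m b θ) n (rotP p q θ) (rotP q p θ) s i j)
      (frameMetricDeriv (rotM m b θ) (rotB m b θ) n (rotP p q θ) (rotP q p θ) i j) θ := by
  apply hasDerivAt_of_deriv_eq
  · fin_cases i <;> fin_cases j <;> simp [frameMetric] <;> fun_prop
  · fin_cases i <;> fin_cases j <;> simp (disch := fun_prop) [frameMetric, frameMetricDeriv] <;>
      ring

theorem pd_invMetric (m b n p q s : ℝ) (i j k : Fin 3) (x : Fin 3 → ℝ) :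
    pd k (fun y => invMetric m b n p q s y i j) x = if k = 2 then
      frameMetricDeriv (rotM m b (x 2)) (rotB m b (x 2)) n (rotP p q (x 2)) (rotP q p (x 2)) i j
      else 0 :=
  pd_comp_apply_two (hasDerivAt_frameMetric m b n p q s (x 2) i j) k

/-- `Sᵀ diag(N, 0) S`, where `S` is the shear by `(p, q)` and `N = !![b, m; m, b]` is minus one
half of the derivative of the planar block `!![m + n, b; b, m - n]` along the boosts. -/
def boostForm (m b p q : ℝ) : Matrix (Fin 3) (Fin 3) ℝ :=
  !![b, m, b * p + m * q; m, b, m * p + b * q;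
    b * p + m * q, m * p + b * q, b * p ^ 2 + 2 * m * p * q + b * q ^ 2]

/-- The planar part of the connection, up to the factor `D`. -/
def planarForm (m b n p q D : ℝ) : Fin 3 → Matrix (Fin 3) (Fin 3) ℝ
  | 0 => !![0, 0, -n * b; 0, 0, D + n ^ 2 - n * m;
        -n * b, D + n ^ 2 - n * m, -2 * n * b * p + (D + 2 * n ^ 2 - 2 * m * n) * q]
  | 1 => !![0, 0, D + n ^ 2 + n * m; 0, 0, n * b;
        D + n ^ 2 + n * m, n * b, (D + 2 * n ^ 2 + 2 * m * n) * p + 2 * n * b * q]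
  | 2 => 0

/-- The Christoffel symbols of a left-invariant metric. -/
noncomputable def christoffelMatrix (m b n p q s D : ℝ) (k : Fin 3) : Matrix (Fin 3) (Fin 3) ℝ :=
  (![-p, -q, 1] k / s) • boostForm m b p q - D⁻¹ • planarForm m b n p q D k

theorem christoffel_invMetric {m b n p q s D : ℝ} (hs : s ≠ 0) (hD : D ≠ 0)
    (h : m ^ 2 - b ^ 2 - n ^ 2 = D) (k i j : Fin 3) (x : Fin 3 → ℝ) :
    christoffel (invMetric m b n p q s) k i j x =
      christoffelMatrix (rotM m b (x 2)) (rotB m b (x 2)) n (rotP p q (x 2)) (rotP q p (x 2)) s D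
        k i j := by
  -- Since `D` is the same at every point, the transported parameters can be generalised to free
  -- ones; what remains is an identity of rational functions.
  have h' : rotM m b (x 2) ^ 2 - rotB m b (x 2) ^ 2 - n ^ 2 = D := by rw [rot_sq_sub_sq, h]
  simp only [christoffel, pd_invMetric]
  rw [invMetric, frameMetric_inv hs hD h']
  generalize rotM m b (x 2) = m at *
  generalize rotB m b (x 2) = b at *
  generalize rotP p q (x 2) = p at *
  generalize rotP q p (x 2) = q at *
  subst h'
  fin_cases k <;> fin_cases i <;> fin_cases j <;>
    simp [frameMetricInv, frameMetricDeriv, christoffelMatrix, boostForm, planarForm,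
      Fin.sum_univ_three] <;>
    field_simp <;> ring

/-- The infinitesimal boost acting on the Lie algebra. -/
def boostGen : Matrix (Fin 3) (Fin 3) ℝ := !![0, 1, 0; 1, 0, 0; 0, 0, 0]

/-- The derivative of the Christoffel symbols along the boosts. -/
noncomputable def christoffelDeriv (m b n p q s D : ℝ) (k i j : Fin 3) : ℝ :=
  ∑ l, (boostGen k l * christoffelMatrix m b n p q s D l i j
    - boostGen l i * christoffelMatrix m b n p q s D k l j
    - boostGen l j * christoffelMatrix m b n p q s D k i l)

/-- Left-invariant coefficients transform as tensors under boosts, so differentiating in the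
rapidity is the action of `boostGen` on each index. The same principle covers the Christoffel
symbols, because boosts act linearly in these coordinates. -/
theorem hasDerivAt_boostForm (m b p q θ : ℝ) (i j : Fin 3) :
    HasDerivAt (fun θ => boostForm (rotM m b θ) (rotB m b θ) (rotP p q θ) (rotP q p θ) i j)
      (-∑ l, (boostGen l i * boostForm (rotM m b θ) (rotB m b θ) (rotP p q θ) (rotP q p θ) l j
        + boostGen l j * boostForm (rotM m b θ) (rotB m b θ) (rotP p q θ) (rotP q p θ) i l)) θ := by
  apply hasDerivAt_of_deriv_eq
  · fin_cases i <;> fin_cases j <;> simp [boostForm] <;> fun_prop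
  · fin_cases i <;> fin_cases j <;>
      simp (disch := fun_prop) [boostForm, boostGen, Fin.sum_univ_three] <;> ring

theorem hasDerivAt_planarForm (m b n p q D θ : ℝ) (k i j : Fin 3) :
    HasDerivAt (fun θ => planarForm (rotM m b θ) (rotB m b θ) n (rotP p q θ) (rotP q p θ) D k i j)
      (∑ l, (boostGen k l *
          planarForm (rotM m b θ) (rotB m b θ) n (rotP p q θ) (rotP q p θ) D l i j
        - boostGen l i * planarForm (rotM m b θ) (rotB m b θ) n (rotP p q θ) (rotP q p θ) D k l j
        - boostGen l j *
          planarForm (rotM m b θ) (rotB m b θ) n (rotP p q θ) (rotP q p θ) D k i l)) θ := by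
  apply hasDerivAt_of_deriv_eq
  · fin_cases k <;> fin_cases i <;> fin_cases j <;> simp [planarForm] <;> fun_prop
  · fin_cases k <;> fin_cases i <;> fin_cases j <;>
      simp (disch := fun_prop) [planarForm, boostGen, Fin.sum_univ_three] <;> ring

theorem hasDerivAt_christoffelMatrix (m b n p q s D θ : ℝ) (k i j : Fin 3) :
    HasDerivAt (fun θ => christoffelMatrix (rotM m b θ) (rotB m b θ) n (rotP p q θ) (rotP q p θ)
        s D k i j)
      (christoffelDeriv (rotM m b θ) (rotB m b θ) n (rotP p q θ) (rotP q p θ) s D k i j) θ := by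
  have hw : HasDerivAt (fun θ => ![-rotP p q θ, -rotP q p θ, 1] k / s)
      (![-rotP q p θ, -rotP p q θ, 0] k / s) θ := by
    refine HasDerivAt.div_const ?_ s
    fin_cases k
    · exact (hasDerivAt_rotP p q θ).neg
    · exact (hasDerivAt_rotP q p θ).neg
    · exact hasDerivAt_const θ 1
  refine ((hw.mul (hasDerivAt_boostForm m b p q θ i j)).sub
    ((hasDerivAt_planarForm m b n p q D θ k i j).const_mul D⁻¹)).congr_deriv ?_
  simp only [christoffelDeriv, christoffelMatrix, Matrix.sub_apply, Matrix.smul_apply, smul_eq_mul,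
    Fin.sum_univ_three]
  generalize boostForm _ _ _ _ = N
  generalize planarForm _ _ _ _ _ _ = A
  fin_cases k <;> simp [boostGen] <;> ring

/-! ### Ricci tensor and its covariant derivative -/

/-- The Ricci tensor of a left-invariant metric. -/
noncomputable def ricciMatrix (m b n p q s D : ℝ) : Matrix (Fin 3) (Fin 3) ℝ :=
  let E := D + n ^ 2
  (2 * n / (s * D)) •
    !![n * m + E, n * b, (n * m + E) * p + n * b * q;
      n * b, n * m - E, n * b * p + (n * m - E) * q;
      (n * m + E) * p + n * b * q, n * b * p + (n * m - E) * q,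
      (n * m + E) * p ^ 2 + 2 * n * b * p * q + (n * m - E) * q ^ 2] +
    !![0, 0, 0; 0, 0, 0; 0, 0, -2 * E / D]

theorem ricci_invMetric {m b n p q s D : ℝ} (hs : s ≠ 0) (hD : D ≠ 0)
    (h : m ^ 2 - b ^ 2 - n ^ 2 = D) (i j : Fin 3) (x : Fin 3 → ℝ) :
    ricci (invMetric m b n p q s) i j x =
      ricciMatrix (rotM m b (x 2)) (rotB m b (x 2)) n (rotP p q (x 2)) (rotP q p (x 2)) s D
        i j := by
  have h' : rotM m b (x 2) ^ 2 - rotB m b (x 2) ^ 2 - n ^ 2 = D := by rw [rot_sq_sub_sq, h]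
  have hΓ : ∀ k i j, christoffel (invMetric m b n p q s) k i j = fun x =>
      christoffelMatrix (rotM m b (x 2)) (rotB m b (x 2)) n (rotP p q (x 2)) (rotP q p (x 2)) s D
        k i j := fun k i j => funext fun x => christoffel_invMetric hs hD h k i j x
  simp only [ricci, curvature, hΓ, pd_comp_apply_two (hasDerivAt_christoffelMatrix m b n p q s D
    (x 2) _ _ _)]
  generalize rotM m b (x 2) = m at *
  generalize rotB m b (x 2) = b at *
  generalize rotP p q (x 2) = p at *
  generalize rotP q p (x 2) = q at *
  subst h'
  clear hΓ h
  fin_cases i <;> fin_cases j <;>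
    simp [christoffelMatrix, boostForm, planarForm, christoffelDeriv, boostGen, ricciMatrix,
      Fin.sum_univ_three] <;>
    field_simp <;> ring

theorem hasDerivAt_ricciMatrix (m b n p q s D θ : ℝ) (i j : Fin 3) :
    HasDerivAt (fun θ => ricciMatrix (rotM m b θ) (rotB m b θ) n (rotP p q θ) (rotP q p θ) s D i j)
      (-∑ l, (boostGen l i *
          ricciMatrix (rotM m b θ) (rotB m b θ) n (rotP p q θ) (rotP q p θ) s D l j
        + boostGen l j *
          ricciMatrix (rotM m b θ) (rotB m b θ) n (rotP p q θ) (rotP q p θ) s D i l)) θ := by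
  apply hasDerivAt_of_deriv_eq
  · fin_cases i <;> fin_cases j <;> simp [ricciMatrix] <;> fun_prop
  · fin_cases i <;> fin_cases j <;>
      simp (disch := fun_prop) [ricciMatrix, boostGen, Fin.sum_univ_three] <;>
      first | ring1 | exact Or.inr (by ring1)

/-- The covariant derivative `∇_l R_{ij}` of a left-invariant metric. -/
noncomputable def covRicciMatrix (m b n p q s D : ℝ) : Fin 3 → Matrix (Fin 3) (Fin 3) ℝ :=
  let Y := 2 * (D + n ^ 2) / (s * D)
  let Z := -(4 * n ^ 2 / (s * D))
  fun
  | 0 => Y • !![0, 0, b; 0, 0, m - n; b, m - n, 2 * (b * p + (m - n) * q)]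
  | 1 => Y • !![0, 0, m + n; 0, 0, b; m + n, b, 2 * ((m + n) * p + b * q)]
  | 2 => Z • !![b, m, b * p + m * q; m, b, m * p + b * q;
        b * p + m * q, m * p + b * q, b * p ^ 2 + 2 * m * p * q + b * q ^ 2] +
      Y • !![0, 0, b * p + (m + n) * q; 0, 0, (m - n) * p + b * q;
        b * p + (m + n) * q, (m - n) * p + b * q, 2 * (b * p ^ 2 + 2 * m * p * q + b * q ^ 2)]

set_option maxHeartbeats 1000000 in
theorem covRicci_invMetric {m b n p q s D : ℝ} (hs : s ≠ 0) (hD : D ≠ 0)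
    (h : m ^ 2 - b ^ 2 - n ^ 2 = D) (k i j : Fin 3) (x : Fin 3 → ℝ) :
    covRicci (invMetric m b n p q s) k i j x =
      covRicciMatrix (rotM m b (x 2)) (rotB m b (x 2)) n (rotP p q (x 2)) (rotP q p (x 2)) s D
        k i j := by
  have h' : rotM m b (x 2) ^ 2 - rotB m b (x 2) ^ 2 - n ^ 2 = D := by rw [rot_sq_sub_sq, h]
  have hR : ∀ i j, ricci (invMetric m b n p q s) i j = fun x =>
      ricciMatrix (rotM m b (x 2)) (rotB m b (x 2)) n (rotP p q (x 2)) (rotP q p (x 2)) s D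
        i j := fun i j => funext fun x => ricci_invMetric hs hD h i j x
  simp only [covRicci, christoffel_invMetric hs hD h, hR,
    pd_comp_apply_two (hasDerivAt_ricciMatrix m b n p q s D (x 2) _ _)]
  generalize rotM m b (x 2) = m at *
  generalize rotB m b (x 2) = b at *
  generalize rotP p q (x 2) = p at *
  generalize rotP q p (x 2) = q at *
  subst h'
  clear hR h
  fin_cases k <;> fin_cases i <;> fin_cases j <;>
    simp [christoffelMatrix, boostForm, planarForm, boostGen, ricciMatrix, covRicciMatrix,
      Fin.sum_univ_three] <;>
    field_simp <;> ring

theorem scalar_invMetric {m b n p q s D : ℝ} (hs : s ≠ 0) (hD : D ≠ 0)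
    (h : m ^ 2 - b ^ 2 - n ^ 2 = D) (x : Fin 3 → ℝ) :
    scalar (invMetric m b n p q s) x = -2 * (D + n ^ 2) / (s * D) := by
  have h' : rotM m b (x 2) ^ 2 - rotB m b (x 2) ^ 2 - n ^ 2 = D := by rw [rot_sq_sub_sq, h]
  simp only [scalar, ricci_invMetric hs hD h]
  rw [invMetric, frameMetric_inv hs hD h']
  generalize rotM m b (x 2) = m at *
  generalize rotB m b (x 2) = b at *
  generalize rotP p q (x 2) = p at *
  generalize rotP q p (x 2) = q at *
  subst h'
  simp [frameMetricInv, ricciMatrix, Fin.sum_univ_three]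
  field_simp
  ring

/-! ### Cotton–York tensor and its norm -/

/-- The Cotton-York tensor with first index raised, up to the factor `√(det g)`. -/
noncomputable def cottonMatrix (m b n p q s D : ℝ) : Matrix (Fin 3) (Fin 3) ℝ :=
  let E := D + n ^ 2
  (2 / (s * D)) •
    !![E * (m + n) + 2 * n ^ 2 * m, b * (E + 2 * n ^ 2),
        (E * (m + n) + 2 * n ^ 2 * m) * p + b * (E + 2 * n ^ 2) * q + 2 * n * E * p;
      -(b * (E + 2 * n ^ 2)), -(E * (m - n) + 2 * n ^ 2 * m),
        -(b * (E + 2 * n ^ 2)) * p - (E * (m - n) + 2 * n ^ 2 * m) * q + 2 * n * E * q;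
      0, 0, -2 * n * E]

theorem cottonYork_invMetric {m b n p q s D : ℝ} (hs : s ≠ 0) (hD : D ≠ 0)
    (h : m ^ 2 - b ^ 2 - n ^ 2 = D) (i j : Fin 3) (x : Fin 3 → ℝ) :
    cottonYork (invMetric m b n p q s) i j x =
      ((1 / √(D * s)) • (invMetric m b n p q s x *
        cottonMatrix (rotM m b (x 2)) (rotB m b (x 2)) n (rotP p q (x 2)) (rotP q p (x 2)) s D))
        i j := by
  have h' : rotM m b (x 2) ^ 2 - rotB m b (x 2) ^ 2 - n ^ 2 = D := by rw [rot_sq_sub_sq, h]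
  have hdet : (invMetric m b n p q s x).det = D * s := by rw [invMetric, frameMetric_det, h']
  -- The scalar curvature of a left-invariant metric is constant, so the trace correction drops out.
  have hpd : ∀ l, pd l (scalar (invMetric m b n p q s)) x = 0 := by
    intro l
    rw [show scalar (invMetric m b n p q s) = fun _ => -2 * (D + n ^ 2) / (s * D) from
      funext (scalar_invMetric hs hD h), pd]
    simp
  simp only [cottonYork, hpd, covRicci_invMetric hs hD h, hdet, Matrix.smul_apply,
    Matrix.mul_apply, smul_eq_mul, Finset.mul_sum]
  -- The index `i` enters only through the factor `g i k`, so the identity is checked for each `k`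
  -- separately.
  refine Finset.sum_congr rfl fun k _ => ?_
  generalize invMetric m b n p q s x i k = G
  generalize √(D * s) = r
  generalize rotM m b (x 2) = m at *
  generalize rotB m b (x 2) = b at *
  generalize rotP p q (x 2) = p at *
  generalize rotP q p (x 2) = q at *
  fin_cases k <;> fin_cases j <;>
    simp [eta, covRicciMatrix, cottonMatrix, Fin.sum_univ_three] <;> ring

theorem trace_cottonMatrix_sq {m b n p q s D : ℝ} (hs : s ≠ 0) (hD : D ≠ 0)
    (h : m ^ 2 - b ^ 2 - n ^ 2 = D) :
    (cottonMatrix m b n p q s D * cottonMatrix m b n p q s D).trace =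
      8 * (D + n ^ 2) * (12 * n ^ 4 + 9 * n ^ 2 * D + D ^ 2) / (D ^ 2 * s ^ 2) := by
  subst h
  simp [cottonMatrix, Matrix.trace_fin_three]
  field_simp
  ring

/-- This is the symmetry of the Cotton–York tensor, needed to write its squared norm as the trace of
a square. -/
theorem frameMetric_mul_cottonMatrix_transpose (m b n p q s : ℝ) {D : ℝ}
    (h : m ^ 2 - b ^ 2 - n ^ 2 = D) :
    (frameMetric m b n p q s * cottonMatrix m b n p q s D).transpose =
      frameMetric m b n p q s * cottonMatrix m b n p q s D := by
  subst h
  ext i j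
  fin_cases i <;> fin_cases j <;>
    simp [cottonMatrix, frameMetric, Matrix.mul_apply, Fin.sum_univ_three] <;> ring

theorem sum_mul_mul_mul_eq_trace {ι R : Type*} [Fintype ι] [CommRing R] (A C : Matrix ι ι R)
    (hA : A.transpose = A) (hC : C.transpose = C) :
    ∑ i, ∑ j, ∑ p, ∑ q, A i p * A j q * C i j * C p q = (A * C * (A * C)).trace := by
  have : A * C * (A * C) = A * C * A.transpose * C.transpose := by
    rw [hA, hC]; simp only [mul_assoc]
  rw [this]
  simp only [Matrix.trace, Matrix.diag, Matrix.mul_apply, Matrix.transpose_apply, Finset.sum_mul]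
  refine Finset.sum_congr rfl fun i _ => Finset.sum_congr rfl fun j _ => ?_
  rw [Finset.sum_comm]
  refine Finset.sum_congr rfl fun q _ => Finset.sum_congr rfl fun p _ => ?_
  ring

theorem frameMetric_transpose (m b n p q s : ℝ) :
    (frameMetric m b n p q s).transpose = frameMetric m b n p q s := by
  ext i j
  fin_cases i <;> fin_cases j <;> rfl

/-- The norm of the Cotton-York tensor times the volume density of a left-invariant metric. -/
theorem cottonYorkNorm_invMetric {m b n p q s D : ℝ} (hs : 0 < s) (hD : 0 < D)
    (h : m ^ 2 - b ^ 2 - n ^ 2 = D) (x : Fin 3 → ℝ) :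
    cottonYorkNorm (invMetric m b n p q s) x * √(invMetric m b n p q s x).det =
      √(8 * (D + n ^ 2) * (12 * n ^ 4 + 9 * n ^ 2 * D + D ^ 2) / (D ^ 2 * s ^ 2)) := by
  have h' : rotM m b (x 2) ^ 2 - rotB m b (x 2) ^ 2 - n ^ 2 = D := by rw [rot_sq_sub_sq, h]
  have hdet : (invMetric m b n p q s x).det = D * s := by rw [invMetric, frameMetric_det, h']
  have hu : IsUnit (invMetric m b n p q s x).det := by
    rw [hdet]; exact (mul_pos hD hs).ne'.isUnit
  have hsym : (invMetric m b n p q s x).transpose = invMetric m b n p q s x :=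
    frameMetric_transpose _ _ _ _ _ _
  -- The factor `det g` cancels the `1 / det g` contributed by the two `ε` symbols, leaving the
  -- trace of the square of `cottonMatrix`.
  rw [cottonYorkNorm, ← Real.sqrt_mul' _ (by rw [hdet]; positivity)]
  congr 1
  simp only [cottonYork_invMetric hs.ne' hD.ne' h]
  rw [sum_mul_mul_mul_eq_trace (invMetric m b n p q s x)⁻¹, hdet, Matrix.mul_smul,
    ← Matrix.mul_assoc, Matrix.nonsing_inv_mul _ hu, Matrix.one_mul, Matrix.smul_mul,
    Matrix.mul_smul, smul_smul, Matrix.trace_smul, trace_cottonMatrix_sq hs.ne' hD.ne' h',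
    smul_eq_mul, div_mul_div_comm, Real.mul_self_sqrt (mul_pos hD hs).le]
  · field_simp
  · rw [Matrix.transpose_nonsing_inv, hsym]
  · rw [Matrix.transpose_smul]
    congr 1
    exact frameMetric_mul_cottonMatrix_transpose _ _ _ _ _ _ h'

/-! ### Left invariance and the normal form of an invariant metric -/

/-- The differential of a left translation. -/
noncomputable def mulDeriv (θ : ℝ) (v : Fin 3 → ℝ) : Fin 3 → ℝ :=
  ![Real.cosh θ * v 0 + Real.sinh θ * v 1, Real.sinh θ * v 0 + Real.cosh θ * v 1, v 2]

theorem fderiv_mul (p q v : Fin 3 → ℝ) : fderiv ℝ (mul p) q v = mulDeriv (p 2) v := by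
  have hi : ∀ i : Fin 3, HasFDerivAt (fun y : Fin 3 → ℝ => y i)
      (ContinuousLinearMap.proj (R := ℝ) (φ := fun _ : Fin 3 => ℝ) i) q := fun i =>
    (ContinuousLinearMap.proj (R := ℝ) (φ := fun _ : Fin 3 => ℝ) i).hasFDerivAt
  have h0 := (((hi 0).const_mul (Real.cosh (p 2))).add
    ((hi 1).const_mul (Real.sinh (p 2)))).add_const (p 0)
  have h1 := (((hi 0).const_mul (Real.sinh (p 2))).add
    ((hi 1).const_mul (Real.cosh (p 2)))).add_const (p 1)
  have h2 := (hi 2).const_add (p 2)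
  have : HasFDerivAt (mul p) (ContinuousLinearMap.pi (![
      Real.cosh (p 2) • .proj 0 + Real.sinh (p 2) • .proj 1,
      Real.sinh (p 2) • .proj 0 + Real.cosh (p 2) • .proj 1, .proj 2] :
        Fin 3 → ((Fin 3 → ℝ) →L[ℝ] ℝ))) q := by
    refine hasFDerivAt_pi.2 fun i => ?_
    fin_cases i
    exacts [h0, h1, h2]
  rw [this.fderiv]
  ext i
  fin_cases i <;> simp [mulDeriv]

theorem mulDeriv_neg (θ : ℝ) (v : Fin 3 → ℝ) : mulDeriv θ (mulDeriv (-θ) v) = v := by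
  have := Real.cosh_sq θ
  ext i
  fin_cases i <;> simp [mulDeriv]
  · linear_combination v 0 * this
  · linear_combination v 1 * this

theorem rotM_add (m b θ φ : ℝ) : rotM m b (θ + φ) = rotM (rotM m b φ) (rotB m b φ) θ := by
  simp only [rotM, rotB, mul_add, Real.cosh_add, Real.sinh_add]; ring

theorem rotB_add (m b θ φ : ℝ) : rotB m b (θ + φ) = rotB (rotM m b φ) (rotB m b φ) θ := by
  simp only [rotM, rotB, mul_add, Real.cosh_add, Real.sinh_add]; ring

theorem rotP_add (p q θ φ : ℝ) : rotP p q (θ + φ) = rotP (rotP p q φ) (rotP q p φ) θ := by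
  simp only [rotP, Real.cosh_add, Real.sinh_add]; ring

theorem mulDeriv_dotProduct_frameMetric (m b n p q s θ : ℝ) (v w : Fin 3 → ℝ) :
    mulDeriv θ v ⬝ᵥ (frameMetric (rotM m b θ) (rotB m b θ) n (rotP p q θ) (rotP q p θ) s).mulVec
      (mulDeriv θ w) = v ⬝ᵥ (frameMetric m b n p q s).mulVec w := by
  simp only [frameMetric, mulDeriv, Matrix.mulVec, dotProduct, Fin.sum_univ_three, rotM, rotB, rotP,
    Real.cosh_two_mul, Real.sinh_two_mul]
  -- In the variable `e = exp θ` the identity becomes rational.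
  rw [Real.cosh_eq, Real.sinh_eq, Real.exp_neg]
  have := Real.exp_pos θ
  generalize Real.exp θ = e at *
  simp
  field_simp
  ring

theorem isLeftInvariant_invMetric (m b n p q s : ℝ) :
    IsLeftInvariant (invMetric m b n p q s) := by
  intro x y v w
  rw [fderiv_mul, fderiv_mul, invMetric, invMetric, show mul x y 2 = x 2 + y 2 by simp [mul],
    rotM_add, rotB_add, rotP_add, rotP_add]
  exact mulDeriv_dotProduct_frameMetric _ _ _ _ _ _ _ _ _

/-- Left translation by `x` takes `0` to `x` with invertible differential, so the value at the
identity determines the metric. -/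
theorem IsLeftInvariant.eq_of_apply_zero {g h : (Fin 3 → ℝ) → Matrix (Fin 3) (Fin 3) ℝ}
    (hg : IsLeftInvariant g) (hh : IsLeftInvariant h) (e : g 0 = h 0) : g = h := by
  funext x
  have key : ∀ v w, v ⬝ᵥ (g x).mulVec w = v ⬝ᵥ (h x).mulVec w := by
    intro v w
    have h1 := hg x 0 (mulDeriv (-(x 2)) v) (mulDeriv (-(x 2)) w)
    have h2 := hh x 0 (mulDeriv (-(x 2)) v) (mulDeriv (-(x 2)) w)
    have hx : mul x 0 = x := by
      ext i; fin_cases i <;> simp [mul]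
    rw [fderiv_mul, fderiv_mul, mulDeriv_neg, mulDeriv_neg, hx] at h1 h2
    rw [h1, h2, e]
  ext i j
  simpa using key (Pi.single i 1) (Pi.single j 1)

theorem frameMetric_posDef {m b n p q s : ℝ} (hm : 0 < m) (hD : 0 < m ^ 2 - b ^ 2 - n ^ 2)
    (hs : 0 < s) : (frameMetric m b n p q s).PosDef := by
  refine Matrix.PosDef.of_dotProduct_mulVec_pos ?_ fun v hv => ?_
  · rw [Matrix.IsHermitian, Matrix.conjTranspose_eq_transpose_of_trivial, frameMetric_transpose]
  have ha : 0 < m + n := by nlinarith [sq_nonneg b]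
  -- Undo the shear, then complete the square in the planar block.
  have e : star v ⬝ᵥ (frameMetric m b n p q s).mulVec v =
      (((m + n) * (v 0 + p * v 2) + b * (v 1 + q * v 2)) ^ 2 +
        (m ^ 2 - b ^ 2 - n ^ 2) * (v 1 + q * v 2) ^ 2) / (m + n) + s * v 2 ^ 2 := by
    simp [frameMetric, Matrix.mulVec, dotProduct, Fin.sum_univ_three]
    field_simp
    ring
  rw [e]
  generalize m ^ 2 - b ^ 2 - n ^ 2 = D at *
  by_cases h2 : v 2 = 0
  · by_cases h1 : v 1 = 0
    · have h0 : v 0 ≠ 0 := fun h0 => hv (by ext i; fin_cases i <;> assumption)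
      simp only [h1, h2, mul_zero, add_zero]
      positivity
    · simp only [h2, mul_zero, add_zero]
      positivity
  · positivity

/-- Hyperbolic rotations preserve the forward timelike cone containing `(m, b)`. -/
theorem rotM_pos {m b : ℝ} (hm : 0 < m) (hb : b ^ 2 < m ^ 2) (θ : ℝ) : 0 < rotM m b θ := by
  have h1 := Real.cosh_pos (2 * θ)
  have h2 := Real.cosh_sq (2 * θ)
  have h3 : b * Real.sinh (2 * θ) < m * Real.cosh (2 * θ) := by
    apply lt_of_pow_lt_pow_left₀ 2 (by positivity)
    nlinarith [sq_nonneg (Real.sinh (2 * θ)), pow_pos hm 2]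
  simp only [rotM]; linarith

theorem isMetric_invMetric {m b n p q s : ℝ} (hm : 0 < m) (hD : 0 < m ^ 2 - b ^ 2 - n ^ 2)
    (hs : 0 < s) : IsMetric (invMetric m b n p q s) := by
  refine ⟨fun i j => ?_, fun x => ?_⟩
  · fin_cases i <;> fin_cases j <;> simp [invMetric, frameMetric, rotM, rotB, rotP] <;> fun_prop
  · refine frameMetric_posDef (rotM_pos hm (by nlinarith [sq_nonneg n]) _) ?_ hs
    rwa [rot_sq_sub_sq]

theorem invMetric_zero (m b n p q s : ℝ) : invMetric m b n p q s 0 = frameMetric m b n p q s := by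
  simp [invMetric, rotM, rotB, rotP]

/-- Block elimination: `(p, q)` comes from Cramer's rule applied to the planar block, and `s` is the
Schur complement, positive because both determinants are. -/
theorem exists_eq_frameMetric {G : Matrix (Fin 3) (Fin 3) ℝ} (hG : G.PosDef) :
    ∃ m b n p q s, 0 < m ∧ 0 < m ^ 2 - b ^ 2 - n ^ 2 ∧ 0 < s ∧ G = frameMetric m b n p q s := by
  have hsym : ∀ i j, G i j = G j i := fun i j => by
    simpa using (hG.isHermitian.apply i j).symm
  have hD : 0 < G 0 0 * G 1 1 - G 0 1 ^ 2 := by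
    have := (hG.submatrix (e := ![0, 1]) (by decide)).det_pos
    rw [Matrix.det_fin_two] at this
    simp [hsym 1 0] at this
    nlinarith
  have h0 : 0 < G 0 0 := hG.diag_pos
  have h1 : 0 < G 1 1 := hG.diag_pos
  set D := G 0 0 * G 1 1 - G 0 1 ^ 2 with hDdef
  set p := (G 1 1 * G 0 2 - G 0 1 * G 1 2) / D with hp
  set q := (G 0 0 * G 1 2 - G 0 1 * G 0 2) / D with hq
  have e : G = frameMetric ((G 0 0 + G 1 1) / 2) (G 0 1) ((G 0 0 - G 1 1) / 2) p q
      (G 2 2 - (G 0 0 * p ^ 2 + 2 * G 0 1 * p * q + G 1 1 * q ^ 2)) := by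
    have e1 : G 0 0 * p + G 0 1 * q = G 0 2 := by
      rw [hp, hq]; field_simp; rw [hDdef]; ring
    have e2 : G 0 1 * p + G 1 1 * q = G 1 2 := by
      rw [hp, hq]; field_simp; rw [hDdef]; ring
    ext i j
    fin_cases i <;> fin_cases j <;>
      simp [frameMetric, hsym 1 0, hsym 2 0, hsym 2 1]
    all_goals first | ring1 | linear_combination -e1 | linear_combination -e2
  refine ⟨_, _, _, _, _, _, by linarith, ?_, ?_, e⟩
  · linarith
  · have := hG.det_pos
    rw [e, frameMetric_det] at this
    exact pos_of_mul_pos_right this (by linarith)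

end IsomMinkowski

/-! ### Conservation laws and the scalar equation for `s` -/

theorem eqOn_Ico_of_hasDerivWithinAt_zero {f : ℝ → ℝ} {T : ℝ}
    (h : ∀ t ∈ Ico 0 T, HasDerivWithinAt f 0 (Ico 0 T) t) : ∀ t ∈ Ico 0 T, f t = f 0 := by
  intro t ht
  have := (convex_Ico 0 T).norm_image_sub_le_of_norm_hasDerivWithin_le (C := 0) h (by simp)
    ⟨le_rfl, ht.1.trans_lt ht.2⟩ ht
  simpa [sub_eq_zero] using this

/-- The solution of `σ' = 4 + κ / σ ^ 2` with initial value `s₀`, and its inverse function. -/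
theorem exists_solution_four_add_div_sq {κ s₀ : ℝ} (hκ : 0 ≤ κ) (hs : 0 < s₀) :
    ∃ σ F : ℝ → ℝ, σ 0 = s₀ ∧ StrictMono σ ∧ Tendsto σ atTop atTop ∧
      (∀ t, 0 ≤ t → HasDerivAt σ (4 + κ / σ t ^ 2) t) ∧ (∀ u, σ (F u) = u) ∧
      ∀ u, s₀ ≤ u → HasDerivAt F (4 + κ / u ^ 2)⁻¹ u := by
  -- Clamping at `s₀` keeps the integrand continuous and bounded below by a positive constant on the
  -- whole line, so that its primitive is a bijection; solutions with `t ≥ 0` never see the clamp.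
  let φ : ℝ → ℝ := fun u => (4 + κ / max u s₀ ^ 2)⁻¹
  have hm : ∀ u, 0 < max u s₀ := fun u => lt_max_of_lt_right hs
  have hden : ∀ u, 0 < 4 + κ / max u s₀ ^ 2 := fun u => by
    have := hm u; positivity
  have hφ : Continuous φ := by
    refine Continuous.inv₀ ?_ fun u => (hden u).ne'
    exact continuous_const.add (continuous_const.div (by fun_prop) fun u => (pow_pos (hm u) 2).ne')
  have hφpos : ∀ u, 0 < φ u := fun u => inv_pos.2 (hden u)
  let c : ℝ := (4 + κ / s₀ ^ 2)⁻¹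
  have hc : 0 < c := by positivity
  have hcφ : ∀ u, c ≤ φ u := fun u => by
    refine inv_anti₀ (hden u) ?_
    gcongr
    exact le_max_right _ _
  let F : ℝ → ℝ := fun u => ∫ x in s₀..u, φ x
  have hF : ∀ u, HasDerivAt F (φ u) u := fun u =>
    intervalIntegral.integral_hasDerivAt_right (hφ.intervalIntegrable _ _)
      (hφ.stronglyMeasurableAtFilter _ _) hφ.continuousAt
  have hFmono : StrictMono F := strictMono_of_hasDerivAt_pos hF hφpos
  have hFcont : Continuous F := continuous_iff_continuousAt.2 fun u => (hF u).continuousAt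
  have hlin : Monotone fun u => F u - c * u :=
    monotone_of_hasDerivAt_nonneg (f' := fun u => φ u - c)
      (fun u => ((hF u).sub ((hasDerivAt_id u).const_mul c)).congr_deriv (by simp))
      fun u => sub_nonneg.2 (hcφ u)
  have hsurj : Function.Surjective F := by
    refine hFcont.surjective ?_ ?_
    · refine tendsto_atTop_mono' _ ?_ (tendsto_atTop_add_const_right _ (F 0)
        (tendsto_id.const_mul_atTop hc))
      filter_upwards [eventually_ge_atTop 0] with u hu
      have := hlin hu
      simp at this ⊢
      linarith
    · refine tendsto_atBot_mono' _ ?_ (tendsto_atBot_add_const_right _ (F 0)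
        (tendsto_id.const_mul_atBot hc))
      filter_upwards [eventually_le_atBot 0] with u hu
      have := hlin hu
      simp at this ⊢
      linarith
  let e := hFmono.orderIsoOfSurjective F hsurj
  have he : ∀ u, e.symm (F u) = u := fun u => e.symm_apply_apply u
  have he' : ∀ t, F (e.symm t) = t := fun t => e.apply_symm_apply t
  have h0 : e.symm 0 = s₀ := by
    have : F s₀ = 0 := intervalIntegral.integral_same
    rw [← this, he]
  refine ⟨e.symm, F, h0, e.symm.strictMono, e.symm.tendsto_atTop, fun t ht => ?_, he,
    fun u hu => ?_⟩
  · have hle : s₀ ≤ e.symm t := h0 ▸ e.symm.monotone ht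
    have := HasDerivAt.of_local_left_inverse (f := F) (g := e.symm) (a := t)
      e.symm.continuous.continuousAt (hF _) (hφpos _).ne' (Eventually.of_forall he')
    simpa [φ, max_eq_left hle] using this
  · simpa [φ, max_eq_left hu] using hF u

/-- Separation of variables: `F (y t) - t` has zero derivative. -/
theorem eq_of_hasDerivWithinAt_four_add_div_sq {κ s₀ T : ℝ} {σ F y : ℝ → ℝ} (hκ : 0 ≤ κ)
    (hσ : ∀ u, σ (F u) = u) (hF : ∀ u, s₀ ≤ u → HasDerivAt F (4 + κ / u ^ 2)⁻¹ u)
    (hσmono : StrictMono σ) (hσ0 : σ 0 = s₀) (hy0 : y 0 = s₀)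
    (hy : ∀ t ∈ Ico 0 T, HasDerivWithinAt y (4 + κ / y t ^ 2) (Ico 0 T) t) :
    ∀ t ∈ Ico 0 T, y t = σ t := by
  -- This holds even where `y t = 0`, as then `κ / 0 = 0`; so `y` is monotone and stays in `[s₀,
  -- ∞)`, where `F` is controlled.
  have hpos : ∀ t, 0 < 4 + κ / y t ^ 2 := fun t => by positivity
  have hmono : MonotoneOn y (Ico 0 T) := by
    refine monotoneOn_of_hasDerivWithinAt_nonneg (f' := fun t => 4 + κ / y t ^ 2) (convex_Ico 0 T)
      (fun t ht => (hy t ht).continuousWithinAt)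
      (fun t ht => (hy t (interior_subset ht)).mono interior_subset) fun t _ => (hpos t).le
  have hle : ∀ t ∈ Ico 0 T, s₀ ≤ y t := fun t ht =>
    hy0 ▸ hmono ⟨le_rfl, ht.1.trans_lt ht.2⟩ ht ht.1
  have hconst := eqOn_Ico_of_hasDerivWithinAt_zero (f := fun t => F (y t) - t) (T := T)
    fun t ht => by
      refine (((hF _ (hle t ht)).comp_hasDerivWithinAt t (hy t ht)).sub
        (hasDerivWithinAt_id t _)).congr_deriv ?_
      rw [inv_mul_cancel₀ (hpos t).ne', sub_self]
  intro t ht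
  have h0 : F s₀ = 0 := hσmono.injective (by rw [hσ, hσ0])
  have := hconst t ht
  simp only [hy0, h0] at this
  rw [← hσ (y t), show F (y t) = t by linarith]

/-! ### The Ricci flow: explicit solution and uniqueness -/

namespace IsomMinkowski

open Riem3

theorem frameMetric_injective {m b n p q s m' b' n' p' q' s' : ℝ}
    (hD : m ^ 2 - b ^ 2 - n ^ 2 ≠ 0)
    (h : frameMetric m b n p q s = frameMetric m' b' n' p' q' s') :
    m = m' ∧ b = b' ∧ n = n' ∧ p = p' ∧ q = q' ∧ s = s' := by
  have e : ∀ i j, frameMetric m b n p q s i j = frameMetric m' b' n' p' q' s' i j := fun i j => by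
    rw [h]
  have e00 := e 0 0
  have e01 := e 0 1
  have e11 := e 1 1
  have e02 := e 0 2
  have e12 := e 1 2
  have e22 := e 2 2
  simp [frameMetric] at e00 e01 e11 e02 e12 e22
  obtain rfl : m = m' := by linarith
  obtain rfl : n = n' := by linarith
  subst e01
  obtain rfl : p = p' := by
    apply mul_left_cancel₀ hD
    linear_combination (m - n) * e02 - b * e12
  obtain rfl : q = q' := by
    apply mul_left_cancel₀ hD
    linear_combination (m + n) * e12 - b * e02
  refine ⟨rfl, rfl, rfl, rfl, rfl, by linarith⟩

/-- For a fixed shear the metric is linear in `(m, b, n, s)`, so the flow equation can be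
differentiated parameter by parameter. -/
theorem frameMetric_eq_sum (m b n p q s : ℝ) (i j : Fin 3) :
    frameMetric m b n p q s i j = m * frameMetric 1 0 0 p q 0 i j +
      b * frameMetric 0 1 0 p q 0 i j + n * frameMetric 0 0 1 p q 0 i j +
      s * frameMetric 0 0 0 p q 1 i j := by
  fin_cases i <;> fin_cases j <;> simp [frameMetric] <;> ring

theorem hasDerivWithinAt_frameMetric {m b n s : ℝ → ℝ} {p q D t : ℝ} {I : Set ℝ}
    (hs : s t ≠ 0) (hD : D ≠ 0)
    (hm' : HasDerivWithinAt m (-(4 * n t ^ 2 / (s t * D)) * m t) I t)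
    (hb' : HasDerivWithinAt b (-(4 * n t ^ 2 / (s t * D)) * b t) I t)
    (hn' : HasDerivWithinAt n (-(4 * (D + n t ^ 2) / (s t * D)) * n t) I t)
    (hs' : HasDerivWithinAt s (4 * (D + n t ^ 2) / D) I t) (i j : Fin 3) :
    HasDerivWithinAt (fun τ => frameMetric (m τ) (b τ) (n τ) p q (s τ) i j)
      (-2 * ricciMatrix (m t) (b t) (n t) p q (s t) D i j) I t := by
  simp only [frameMetric_eq_sum (m _) (b _)]
  refine ((((hm'.mul_const _).add (hb'.mul_const _)).add (hn'.mul_const _)).add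
    (hs'.mul_const _)).congr_deriv ?_
  fin_cases i <;> fin_cases j <;> simp [frameMetric, ricciMatrix] <;> field_simp <;> ring

theorem rotM_mul (r m b θ : ℝ) : rotM (r * m) (r * b) θ = r * rotM m b θ := by
  simp only [rotM]; ring

theorem rotB_mul (r m b θ : ℝ) : rotB (r * m) (r * b) θ = r * rotB m b θ := by
  simp only [rotB]; ring

/-- The factor by which the traceful part of the planar metric scales along the Ricci flow, where
`c = n * s` and `D` are conserved. -/
noncomputable def planarScale (D n c s : ℝ) : ℝ := √((D + (c / s) ^ 2) / (D + n ^ 2))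

/-- The Ricci flow, as a function of the length `s` of the boost direction. -/
noncomputable def flowMetric (m b n p q D c s : ℝ) : (Fin 3 → ℝ) → Matrix (Fin 3) (Fin 3) ℝ :=
  invMetric (planarScale D n c s * m) (planarScale D n c s * b) (c / s) p q s

theorem planarScale_pos {D : ℝ} (hD : 0 < D) (n c s : ℝ) : 0 < planarScale D n c s :=
  Real.sqrt_pos.2 (by positivity)

theorem planarScale_sq {D : ℝ} (hD : 0 < D) (n c s : ℝ) :
    planarScale D n c s ^ 2 * (D + n ^ 2) = D + (c / s) ^ 2 := by
  have : D + n ^ 2 ≠ 0 := by positivity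
  rw [planarScale, Real.sq_sqrt (by positivity), div_mul_cancel₀ _ this]

theorem flow_discriminant {m b n D : ℝ} (hD : 0 < D) (h : m ^ 2 - b ^ 2 - n ^ 2 = D) (c s : ℝ) :
    (planarScale D n c s * m) ^ 2 - (planarScale D n c s * b) ^ 2 - (c / s) ^ 2 = D := by
  have := planarScale_sq hD n c s
  linear_combination this + planarScale D n c s ^ 2 * h

theorem hasDerivAt_flowMetric {m b n p q D c t : ℝ} {σ : ℝ → ℝ} (hD : 0 < D)
    (h : m ^ 2 - b ^ 2 - n ^ 2 = D) (hσ : 0 < σ t)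
    (hσ' : HasDerivAt σ (4 + 4 * c ^ 2 / D / σ t ^ 2) t) (x : Fin 3 → ℝ) (i j : Fin 3)
    (I : Set ℝ) :
    HasDerivWithinAt (fun τ => flowMetric m b n p q D c (σ τ) x i j)
      (-2 * ricci (flowMetric m b n p q D c (σ t)) i j x) I t := by
  have hn' : HasDerivAt (fun τ => c / σ τ)
      (-(4 * (D + (c / σ t) ^ 2) / (σ t * D)) * (c / σ t)) t := by
    refine ((hasDerivAt_const t c).div hσ' hσ.ne').congr_deriv ?_
    field_simp
    ring
  have hE : 0 < (D + (c / σ t) ^ 2) / (D + n ^ 2) := by positivity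
  have hρ' : HasDerivAt (fun τ => planarScale D n c (σ τ))
      (-(4 * (c / σ t) ^ 2 / (σ t * D)) * planarScale D n c (σ t)) t := by
    refine ((((hn'.pow 2).const_add D).div_const (D + n ^ 2)).sqrt hE.ne').congr_deriv ?_
    have h1 := planarScale_sq hD n c (σ t)
    have h2 := planarScale_pos hD n c (σ t)
    have h3 : 0 < D + n ^ 2 := by positivity
    change _ / (2 * planarScale D n c (σ t)) = _
    generalize planarScale D n c (σ t) = ρ at *
    rw [div_eq_iff (by positivity), div_eq_iff h3.ne']
    linear_combination (8 * (c / σ t) ^ 2 / (σ t * D)) * h1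
  have hm' : HasDerivAt (fun τ => planarScale D n c (σ τ) * rotM m b (x 2))
      (-(4 * (c / σ t) ^ 2 / (σ t * D)) * (planarScale D n c (σ t) * rotM m b (x 2))) t :=
    (hρ'.mul_const _).congr_deriv (by ring)
  have hb' : HasDerivAt (fun τ => planarScale D n c (σ τ) * rotB m b (x 2))
      (-(4 * (c / σ t) ^ 2 / (σ t * D)) * (planarScale D n c (σ t) * rotB m b (x 2))) t :=
    (hρ'.mul_const _).congr_deriv (by ring)
  have hs' : HasDerivAt σ (4 * (D + (c / σ t) ^ 2) / D) t :=
    hσ'.congr_deriv (by field_simp)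
  rw [flowMetric, ricci_invMetric hσ.ne' hD.ne' (flow_discriminant hD h c (σ t))]
  simp only [flowMetric, invMetric, rotM_mul, rotB_mul]
  exact hasDerivWithinAt_frameMetric (n := fun τ => c / σ τ) hσ.ne' hD.ne' hm'.hasDerivWithinAt
    hb'.hasDerivWithinAt hn'.hasDerivWithinAt hs'.hasDerivWithinAt i j

theorem flowMetric_self {m b n p q D s : ℝ} (hD : 0 < D) (hs : s ≠ 0) :
    flowMetric m b n p q D (n * s) s = invMetric m b n p q s := by
  have hn : n * s / s = n := by field_simp
  have : planarScale D n (n * s) s = 1 := by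
    rw [planarScale, hn, div_self (by positivity), Real.sqrt_one]
  rw [flowMetric, this, hn, one_mul, one_mul]

theorem isMetric_flowMetric {m b n p q D c s : ℝ} (hm : 0 < m) (hD : 0 < D)
    (h : m ^ 2 - b ^ 2 - n ^ 2 = D) (hs : 0 < s) : IsMetric (flowMetric m b n p q D c s) :=
  isMetric_invMetric (mul_pos (planarScale_pos hD _ _ _) hm)
    (by rwa [flow_discriminant hD h]) hs

/-- The `L¹`-norm of the Cotton-York tensor along the flow depends only on `s`. -/
theorem cottonYorkL1_flowMetric {m b n p q D c s : ℝ} (hD : 0 < D)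
    (h : m ^ 2 - b ^ 2 - n ^ 2 = D) (hs : 0 < s) (K : Set (Fin 3 → ℝ)) :
    cottonYorkL1 (flowMetric m b n p q D c s) K =
      volume.real K * √(8 * (D + c ^ 2 * (1 / s) ^ 2) *
        (12 * c ^ 4 * (1 / s) ^ 4 + 9 * c ^ 2 * (1 / s) ^ 2 * D + D ^ 2) / D ^ 2 * (1 / s) ^ 2) := by
  simp only [cottonYorkL1, flowMetric,
    cottonYorkNorm_invMetric hs hD (flow_discriminant hD h c s), setIntegral_const, smul_eq_mul]
  congr 2
  field_simp

/-- The parameters of an arbitrary invariant flow are chosen time by time, with no regularity known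
in advance. Their derivatives are recovered from those of the matrix entries, and the conserved
quantities then force the explicit solution. -/
theorem eq_flowMetric {m b n p q D s T : ℝ} {σ F : ℝ → ℝ} (hm : 0 < m) (hD : 0 < D)
    (hd : m ^ 2 - b ^ 2 - n ^ 2 = D)
    (hσ : ∀ u, σ (F u) = u)
    (hF : ∀ u, s ≤ u → HasDerivAt F (4 + 4 * (n * s) ^ 2 / D / u ^ 2)⁻¹ u)
    (hσmono : StrictMono σ) (hσ0 : σ 0 = s)
    {h : ℝ → (Fin 3 → ℝ) → Matrix (Fin 3) (Fin 3) ℝ}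
    (hh : IsInvariantRicciFlow (Ico 0 T) (invMetric m b n p q s) h) (t : ℝ) (ht : t ∈ Ico 0 T) :
    h t = flowMetric m b n p q D (n * s) (σ t) := by
  obtain ⟨⟨hmet, hric⟩, hinv, h0⟩ := hh
  have hz : (0 : ℝ) ∈ Ico 0 T := ⟨le_rfl, ht.1.trans_lt ht.2⟩
  choose! m' b' n' p' q' s' hm' hD' hs' hG using fun t (ht : t ∈ Ico 0 T) =>
    exists_eq_frameMetric ((hmet t ht).2 0)
  have hG' : ∀ t ∈ Ico 0 T, h t = invMetric (m' t) (b' t) (n' t) (p' t) (q' t) (s' t) :=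
    fun t ht => (hinv t ht).eq_of_apply_zero (isLeftInvariant_invMetric _ _ _ _ _ _)
      (by rw [hG t ht, invMetric_zero])
  obtain ⟨m0, b0, n0, p0, q0, s0⟩ : m = m' 0 ∧ b = b' 0 ∧ n = n' 0 ∧ p = p' 0 ∧ q = q' 0 ∧
      s = s' 0 := by
    apply frameMetric_injective (by rw [hd]; exact hD.ne')
    rw [← hG 0 hz, h0, invMetric_zero]
  have hder : ∀ t ∈ Ico 0 T, ∀ i j, HasDerivWithinAt
      (fun τ => frameMetric (m' τ) (b' τ) (n' τ) (p' τ) (q' τ) (s' τ) i j)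
      (-2 * ricciMatrix (m' t) (b' t) (n' t) (p' t) (q' t) (s' t)
        (m' t ^ 2 - b' t ^ 2 - n' t ^ 2) i j) (Ico 0 T) t := by
    intro t ht i j
    have e := hric t ht 0 i j
    rw [hG' t ht, ricci_invMetric (hs' t ht).ne' (hD' t ht).ne' rfl] at e
    simp only [Pi.zero_apply] at e
    refine (e.congr (fun τ hτ => by rw [hG τ hτ]) (by rw [hG t ht])).congr_deriv ?_
    simp [rotM, rotB, rotP]
  have hm₁ : ∀ t ∈ Ico 0 T, HasDerivWithinAt m' (-(4 * n' t ^ 2 / (s' t *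
      (m' t ^ 2 - b' t ^ 2 - n' t ^ 2))) * m' t) (Ico 0 T) t := by
    intro t ht
    have e := ((hder t ht 0 0).add (hder t ht 1 1)).div_const 2
    refine (e.congr (fun τ _ => ?_) ?_).congr_deriv ?_
    · simp [frameMetric]
    · simp [frameMetric]
    · simp [ricciMatrix]; ring
  have hn₁ : ∀ t ∈ Ico 0 T, HasDerivWithinAt n' (-(4 * (m' t ^ 2 - b' t ^ 2) / (s' t *
      (m' t ^ 2 - b' t ^ 2 - n' t ^ 2))) * n' t) (Ico 0 T) t := by
    intro t ht
    have e := ((hder t ht 0 0).sub (hder t ht 1 1)).div_const 2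
    refine (e.congr (fun τ _ => ?_) ?_).congr_deriv ?_
    · simp [frameMetric]
    · simp [frameMetric]
    · simp [ricciMatrix]; ring
  have hb₁ : ∀ t ∈ Ico 0 T, HasDerivWithinAt b' (-(4 * n' t ^ 2 / (s' t *
      (m' t ^ 2 - b' t ^ 2 - n' t ^ 2))) * b' t) (Ico 0 T) t := by
    intro t ht
    refine ((hder t ht 0 1).congr (fun τ _ => ?_) ?_).congr_deriv ?_
    · simp [frameMetric]
    · simp [frameMetric]
    · simp [ricciMatrix]; ring
  have hDc : ∀ t ∈ Ico 0 T, m' t ^ 2 - b' t ^ 2 - n' t ^ 2 = D := by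
    intro t ht
    have := eqOn_Ico_of_hasDerivWithinAt_zero
      (f := fun t => m' t ^ 2 - b' t ^ 2 - n' t ^ 2) (T := T) (fun t ht => by
        refine ((((hm₁ t ht).pow 2).sub ((hb₁ t ht).pow 2)).sub ((hn₁ t ht).pow 2)).congr_deriv ?_
        push_cast
        ring) t ht
    simpa only [← m0, ← b0, ← n0, hd] using this
  -- By Cramer's rule the two combinations below equal `D p'` and `D q'`. They involve only
  -- quantities already known to be differentiable, and both are constant.
  have hp : ∀ t ∈ Ico 0 T, p' t = p ∧ q' t = q := by
    intro t ht
    have e1 := eqOn_Ico_of_hasDerivWithinAt_zero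
      (f := fun t => (m' t - n' t) * frameMetric (m' t) (b' t) (n' t) (p' t) (q' t) (s' t) 0 2 -
        b' t * frameMetric (m' t) (b' t) (n' t) (p' t) (q' t) (s' t) 1 2) (T := T) (fun t ht => by
        refine ((((hm₁ t ht).sub (hn₁ t ht)).mul (hder t ht 0 2)).sub
          ((hb₁ t ht).mul (hder t ht 1 2))).congr_deriv ?_
        have := hs' t ht
        have := hD' t ht
        simp [frameMetric, ricciMatrix]
        field_simp
        ring) t ht
    have e2 := eqOn_Ico_of_hasDerivWithinAt_zero
      (f := fun t => (m' t + n' t) * frameMetric (m' t) (b' t) (n' t) (p' t) (q' t) (s' t) 1 2 -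
        b' t * frameMetric (m' t) (b' t) (n' t) (p' t) (q' t) (s' t) 0 2) (T := T) (fun t ht => by
        refine ((((hm₁ t ht).add (hn₁ t ht)).mul (hder t ht 1 2)).sub
          ((hb₁ t ht).mul (hder t ht 0 2))).congr_deriv ?_
        have := hs' t ht
        have := hD' t ht
        simp [frameMetric, ricciMatrix]
        field_simp
        ring) t ht
    simp only [← m0, ← b0, ← n0, ← p0, ← q0, ← s0] at e1 e2
    simp [frameMetric] at e1 e2
    have e3 := hDc t ht
    constructor <;> apply mul_left_cancel₀ hD.ne'
    · linear_combination e1 - p' t * e3 + p * hd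
    · linear_combination e2 - q' t * e3 + q * hd
  -- With the shear constant, `s = g₂₂ - p g₀₂ - q g₁₂` is a fixed linear combination of entries.
  have hs₁ : ∀ t ∈ Ico 0 T, HasDerivWithinAt s' (4 * (D + n' t ^ 2) / D) (Ico 0 T) t := by
    intro t ht
    have e := ((hder t ht 2 2).sub ((hder t ht 0 2).const_mul p)).sub
      ((hder t ht 1 2).const_mul q)
    refine (e.congr_of_mem (fun τ hτ => ?_) ht).congr_deriv ?_
    · obtain ⟨e1, e2⟩ := hp τ hτ
      simp [frameMetric, e1, e2]
      ring
    · obtain ⟨e1, e2⟩ := hp t ht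
      rw [hDc t ht]
      simp [ricciMatrix, e1, e2]
      ring
  have hns : ∀ t ∈ Ico 0 T, n' t * s' t = n * s := by
    intro t ht
    have := eqOn_Ico_of_hasDerivWithinAt_zero (f := fun t => n' t * s' t) (T := T) (fun t ht => by
        refine ((hn₁ t ht).mul (hs₁ t ht)).congr_deriv ?_
        have e := hDc t ht
        have := hs' t ht
        rw [e, show m' t ^ 2 - b' t ^ 2 = D + n' t ^ 2 by linarith]
        field_simp
        ring) t ht
    simpa only [← n0, ← s0] using this
  have hsσ : ∀ t ∈ Ico 0 T, s' t = σ t := by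
    refine eq_of_hasDerivWithinAt_four_add_div_sq (κ := 4 * (n * s) ^ 2 / D) (by positivity) hσ hF
      hσmono hσ0 s0.symm fun t ht => ?_
    refine (hs₁ t ht).congr_deriv ?_
    have := hs' t ht
    rw [← hns t ht]
    field_simp
  have hbm : ∀ t ∈ Ico 0 T, b' t * m = b * m' t := by
    intro t ht
    have := eqOn_Ico_of_hasDerivWithinAt_zero (f := fun t => b' t / m' t) (T := T) (fun t ht => by
        refine ((hb₁ t ht).div (hm₁ t ht) (hm' t ht).ne').congr_deriv ?_
        ring) t ht
    simp only [← b0, ← m0] at this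
    rwa [div_eq_div_iff (hm' t ht).ne' hm.ne'] at this
  have hst := hs' t ht
  have hn : n' t = n * s / σ t := by
    rw [← hsσ t ht, eq_div_iff hst.ne', hns t ht]
  have hρ := planarScale_pos hD n (n * s) (σ t)
  have hρ2 := planarScale_sq hD n (n * s) (σ t)
  rw [← hn] at hρ2
  have hmt : m' t = planarScale D n (n * s) (σ t) * m := by
    -- The value of `m'² - b'²` and the ratio `b' / m'` determine `m'²`; positivity selects the
    -- root.
    rw [← sq_eq_sq₀ (hm' t ht).le (mul_pos hρ hm).le]
    have hE : D + n ^ 2 ≠ 0 := by positivity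
    apply mul_left_cancel₀ hE
    linear_combination (-m ^ 2) * hρ2 + m ^ 2 * hDc t ht + (b' t * m + b * m' t) * hbm t ht -
      m' t ^ 2 * hd
  have hbt : b' t = planarScale D n (n * s) (σ t) * b := by
    apply mul_right_cancel₀ hm.ne'
    rw [hbm t ht, hmt]
    ring
  rw [hG' t ht, flowMetric, hmt, hbt, hn, (hp t ht).1, (hp t ht).2, hsσ t ht]

end IsomMinkowski

/-! ### Assembly of the theorem -/

open IsomMinkowski Riem3 in
theorem theorem3p10 (g₀ : (Fin 3 → ℝ) → Matrix (Fin 3) (Fin 3) ℝ)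
    (hg₀ : Riem3.IsMetric g₀) (hinv : IsomMinkowski.IsLeftInvariant g₀) :
    ∃ g : ℝ → (Fin 3 → ℝ) → Matrix (Fin 3) (Fin 3) ℝ,
      IsomMinkowski.IsInvariantRicciFlow (Ici 0) g₀ g ∧
      (∀ (T : ℝ) (h : ℝ → (Fin 3 → ℝ) → Matrix (Fin 3) (Fin 3) ℝ),
        IsomMinkowski.IsInvariantRicciFlow (Ico 0 T) g₀ h → ∀ t ∈ Ico 0 T, h t = g t) ∧
      ∀ K : Set (Fin 3 → ℝ), IsCompact K →
        Tendsto (fun t => Riem3.cottonYorkL1 (g t) K) atTop (𝓝 0) ∧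
        (volume K ≠ 0 → StrictAntiOn (fun t => Riem3.cottonYorkL1 (g t) K) (Ici 0)) := by
  obtain ⟨m, b, n, p, q, s, hm, hD, hs, hG⟩ := exists_eq_frameMetric (hg₀.2 0)
  obtain ⟨D, hd⟩ : ∃ D, m ^ 2 - b ^ 2 - n ^ 2 = D := ⟨_, rfl⟩
  rw [hd] at hD
  obtain rfl : g₀ = invMetric m b n p q s :=
    hinv.eq_of_apply_zero (isLeftInvariant_invMetric _ _ _ _ _ _) (by rw [hG, invMetric_zero])
  obtain ⟨σ, F, hσ0, hmono, htop, hσ', hσF, hF⟩ :=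
    exists_solution_four_add_div_sq (κ := 4 * (n * s) ^ 2 / D) (by positivity) hs
  have hσpos : ∀ t, 0 ≤ t → 0 < σ t := fun t ht =>
    hs.trans_le (hσ0 ▸ hmono.monotone ht)
  have hL := fun (K : Set (Fin 3 → ℝ)) (t : ℝ) (ht : 0 ≤ t) =>
    cottonYorkL1_flowMetric (p := p) (q := q) (c := n * s) hD hd (hσpos t ht) K
  refine ⟨fun t => flowMetric m b n p q D (n * s) (σ t), ⟨⟨fun t ht => ?_, fun t ht x i j => ?_⟩,
    fun t _ => isLeftInvariant_invMetric _ _ _ _ _ _, ?_⟩, fun T h hh t ht => ?_,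
    fun K hK => ⟨?_, fun hK0 => ?_⟩⟩
  · exact isMetric_flowMetric hm hD hd (hσpos t ht)
  · exact hasDerivAt_flowMetric hD hd (hσpos t ht) (hσ' t ht) x i j _
  · simp only [hσ0]
    exact flowMetric_self hD hs.ne'
  · exact eq_flowMetric hm hD hd hσF hF hmono hσ0 hh t ht
  · have hu : Tendsto (fun t => 1 / σ t) atTop (𝓝 0) :=
      htop.inv_tendsto_atTop.congr fun t => (one_div _).symm
    let Ψ : ℝ → ℝ := fun u => volume.real K * √(8 * (D + (n * s) ^ 2 * u ^ 2) *
        (12 * (n * s) ^ 4 * u ^ 4 + 9 * (n * s) ^ 2 * u ^ 2 * D + D ^ 2) / D ^ 2 * u ^ 2)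
    have hΨ : Continuous Ψ := by fun_prop
    have h0 : Ψ 0 = 0 := by simp [Ψ]
    have := (hΨ.tendsto 0).comp hu
    rw [h0] at this
    refine this.congr' ?_
    filter_upwards [eventually_ge_atTop 0] with t ht
    exact (hL K t ht).symm
  · intro t ht t' ht' htt'
    simp only [hL K t ht, hL K t' ht']
    have hK' : 0 < volume.real K :=
      ENNReal.toReal_pos hK0 hK.measure_lt_top.ne
    have h1 := hσpos t ht
    have h2 := hσpos t' ht'
    have hlt : 1 / σ t' < 1 / σ t := one_div_lt_one_div_of_lt h1 (hmono htt')
    have hpos : 0 < 1 / σ t' := by positivity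
    generalize 1 / σ t' = u' at *
    generalize 1 / σ t = u at *
    have hu : 0 < u := hpos.trans hlt
    refine mul_lt_mul_of_pos_left (Real.sqrt_lt_sqrt (by positivity) ?_) hK'
    -- The strict increase comes from the factor `u ^ 2`; the other factor is only weakly
    -- increasing, being constant when `n = 0`.
    refine mul_lt_mul' ?_ (by gcongr) (by positivity) (by positivity)
    gcongr
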